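/- \textbf{Theorem (Asymptotic stability).} Let $p\le n$, equip $\mathbb{R}^{n\times p}$ with the Frobenius inner product $\langle X,Y\rangle=\mathrm{tr}(X^\top Y)$ and norm $\|\cdot\|_{\mathrm F}$, and let $\mathrm{St}(p,n)=\{X\in\mathbb{R}^{n\times p}: X^\top X=I_p\}$, with tangent spaces $\mathrm{T}_X\mathrm{St}(p,n)=\{\xi\in\mathbb{R}^{n\times p}:\xi^\top X+X^\top\xi=0\}$. Let $f:\mathbb{R}^{n\times p}\to\mathbb{R}$ be continuously differentiable with locally Lipschitz continuous gradient $\nabla f$, and let $\lambda>0$. Define $$\Lambda(X)=\psi(X)X+\lambda\nabla\mathcal{N}(X),\qquad \psi(X)=2\,\mathrm{skew}\big(\nabla f(X)X^\top\big),\qquad \mathcal{N}(X)=\tfrac14\|X^\top X-I_p\|_{\mathrm F}^2,$$ where $\mathrm{skew}(A)=\frac12(A-A^\top)$. A critical point of $f$ relative to $\mathrm{St}(p,n)$ is a point $X\in\mathrm{St}(p,n)$ with $\mathrm{D}f(X)[\xi]=0$ for all $\xi\in\mathrm{T}_X\mathrm{St}(p,n)$. If $X^*\in\mathrm{St}(p,n)$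 is a local minimum of $f$ relative to $\mathrm{St}(p,n)$ and an isolated critical point of $f$ relative to $\mathrm{St}(p,n)$ (that is, it is a critical point and has a neighbourhood that contains no other one), then $X^*$ is an asymptotically stable equilibrium of the landing system $\dot X(t)=-\Lambda(X(t))$, that is: \begin{enumerate} \item $X^*$ is an equilibrium: $\Lambda(X^*)=0$; \item $X^*$ is stable: for every $\epsilon>0$ there is $\delta>0$ such that for every $X_0\in\mathbb{R}^{n\times p}$ with $\|X_0-X^*\|_{\mathrm F}<\delta$, a solution with $X(0)=X_0$ defined for all $t\ge0$ exists, and every such solution satisfies $\|X(t)-X^*\|_{\mathrm F}<\epsilon$ for all $t\ge 0$; \item $X^*$ is attractive: there is $\delta>0$ such that every solution $X:[0,\infty)\to\mathbb{R}^{n\times p}$ with $\|X(0)-X^*\|_{\mathrm F}<\delta$ satisfies $\lim_{t\to+\infty}X(t)=X^*$. \end{enumerate} -/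

import Mathlib

open Filter Topology Set
open scoped Matrix Gradient

attribute [local instance] Matrix.frobeniusNormedAddCommGroup Matrix.frobeniusNormedSpace

/-- Real `n × p` matrices with the Frobenius inner product `⟨X, Y⟩ = tr (Xᵀ Y)`.
The underlying norm is Mathlib's Frobenius norm. -/
@[reducible]
noncomputable def Matrix.frobeniusInnerProductSpaceReal (n p : ℕ) :
    InnerProductSpace ℝ (Matrix (Fin n) (Fin p) ℝ) :=
  { Matrix.frobeniusNormedSpace with
    inner := fun X Y => (Xᵀ * Y).trace
    norm_sq_eq_re_inner := by
      intro X
      have h0 : 0 ≤ ∑ i, ∑ j, ‖X i j‖ ^ (2 : ℝ) := by positivity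
      rw [Matrix.frobenius_norm_def, ← Real.rpow_natCast, ← Real.rpow_mul h0]
      simp [Matrix.trace, Matrix.mul_apply, pow_two]
      rw [Finset.sum_comm]
    conj_inner_symm := by
      intro X Y
      simp only [conj_trivial]
      rw [← Matrix.trace_transpose, Matrix.transpose_mul, Matrix.transpose_transpose]
    add_left := by
      intro X Y Z
      simp [Matrix.add_mul]
    smul_left := by
      intro X Y r
      simp }

attribute [local instance] Matrix.frobeniusInnerProductSpaceReal

namespace Landing

/-- The Stiefel manifold `St(p, n)`, as a subset of `ℝ^{n × p}`. -/
def stiefel (n p : ℕ) : Set (Matrix (Fin n) (Fin p) ℝ) :=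
  {X | Xᵀ * X = 1}

/-- The tangent space `T_X St(p, n)` (meaningful for `X ∈ St(p, n)`). -/
def tangentSpace {n p : ℕ} (X : Matrix (Fin n) (Fin p) ℝ) :
    Set (Matrix (Fin n) (Fin p) ℝ) :=
  {ξ | ξᵀ * X + Xᵀ * ξ = 0}

/-- The critical points of `f` relative to `St(p, n)`: the points of `St(p, n)` at which the
derivative of `f` vanishes on the tangent space of `St(p, n)`. -/
def criticalPoints {n p : ℕ} (f : Matrix (Fin n) (Fin p) ℝ → ℝ) :
    Set (Matrix (Fin n) (Fin p) ℝ) :=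
  {X | X ∈ stiefel n p ∧ ∀ ξ ∈ tangentSpace X, fderiv ℝ f X ξ = 0}

/-- `X` is a critical point of `f` relative to `St(p, n)`, and the only one in some
neighbourhood of `X`. -/
def IsIsolatedCriticalPoint {n p : ℕ} (f : Matrix (Fin n) (Fin p) ℝ → ℝ)
    (X : Matrix (Fin n) (Fin p) ℝ) : Prop :=
  X ∈ criticalPoints f ∧ ∃ ε > 0, ∀ Y ∈ criticalPoints f, ‖Y - X‖ < ε → Y = X

/-- The skew-symmetric part of a square matrix. -/
noncomputable def skewPart {n : ℕ} (A : Matrix (Fin n) (Fin n) ℝ) :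
    Matrix (Fin n) (Fin n) ℝ :=
  (1 / 2 : ℝ) • (A - Aᵀ)

/-- `ψ(X) = 2 skew(∇f(X) Xᵀ)`; the gradient is taken for the Frobenius inner product. -/
noncomputable def psi {n p : ℕ} (f : Matrix (Fin n) (Fin p) ℝ → ℝ)
    (X : Matrix (Fin n) (Fin p) ℝ) : Matrix (Fin n) (Fin n) ℝ :=
  (2 : ℝ) • skewPart (∇ f X * Xᵀ)

/-- The penalty `𝒩(X) = ‖Xᵀ X - I‖² / 4`, in the Frobenius norm. -/
noncomputable def penalty {n p : ℕ} (X : Matrix (Fin n) (Fin p) ℝ) : ℝ :=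
  (1 / 4 : ℝ) * ‖Xᵀ * X - 1‖ ^ 2

/-- The landing field `Λ(X) = ψ(X) X + lam ∇𝒩(X)` with regularization parameter `lam`. -/
noncomputable def landingField {n p : ℕ} (f : Matrix (Fin n) (Fin p) ℝ → ℝ) (lam : ℝ)
    (X : Matrix (Fin n) (Fin p) ℝ) : Matrix (Fin n) (Fin p) ℝ :=
  psi f X * X + lam • ∇ (penalty (n := n) (p := p)) X

section Dynamics

variable {E : Type*} [NormedAddCommGroup E] [NormedSpace ℝ E]

/-- `x` solves the autonomous system `ẋ(t) = V (x t)` for all `t ≥ 0`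
(with the one-sided derivative at `t = 0`). Only the values `x t` with `t ≥ 0` matter. -/
def IsSolution (V : E → E) (x : ℝ → E) : Prop :=
  ∀ t ∈ Ici (0 : ℝ), HasDerivWithinAt x (V (x t)) (Ici 0) t

/-- `e` is an equilibrium point of the system `ẋ = V x`. -/
def IsEquilibrium (V : E → E) (e : E) : Prop :=
  V e = 0

/-- Lyapunov stability of the point `e` for `ẋ = V x`. It includes the fact that the system can
be solved for all `t ≥ 0` from every initial point close to `e`, so that the clause on solutions
is never void. -/
def IsStable (V : E → E) (e : E) : Prop :=
  ∀ ε > 0, ∃ δ > 0, ∀ x₀ : E, ‖x₀ - e‖ < δ →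
    (∃ x : ℝ → E, IsSolution V x ∧ x 0 = x₀) ∧
      ∀ x : ℝ → E, IsSolution V x → x 0 = x₀ → ∀ t ≥ 0, ‖x t - e‖ < ε

/-- `e` is an asymptotically stable equilibrium of `ẋ = V x`: it is a stable equilibrium, and the
solutions that start close enough to `e` converge to `e`. -/
def IsAsymptoticallyStable (V : E → E) (e : E) : Prop :=
  IsEquilibrium V e ∧ IsStable V e ∧
    ∃ δ > 0, ∀ x : ℝ → E, IsSolution V x → ‖x 0 - e‖ < δ → Tendsto x atTop (𝓝 e)

end Dynamics

end Landing

/-! The two parts of `Λ` are orthogonal: `ψ(X)` is skew, so moving along `ψ(X) X` does not change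
the defect `R = Xᵀ X - I`. Hence `q = ‖R‖²` has derivative `-4λ‖X R‖²` along the flow. Near the
Stiefel manifold this is at most `-2λ q`, so `√q` decays like `exp(-λ t)`. On the other hand `⟨∇f, ψ
X⟩ = ½‖ψ‖²`, so `f` decreases at rate `w = ½‖ψ‖²` up to an error `λ M √q`, whose integral over all
time is at most `M √q(0)`.

On the manifold `ψ` vanishes exactly at the critical points. A nearby point of the manifold with the
same value of `f` as `X*` would be a local minimum too, hence critical. Isolation therefore makes
`X*` a strict minimum and the only nearby zero of `w`.

`IsCascadeLyapunov` records these facts. Stability: at a first exit through a small sphere, `q` is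
small, so `f` exceeds `f(X*)` by a fixed amount, more than the integrated error allows.
Attractivity: a confined trajectory staying away from `X*` would eventually have `w` bounded below,
driving `f` to `-∞` on a compact ball. So it comes arbitrarily close to `X*`, and stability keeps it
there. -/

namespace Landing

/-! ### Cascade Lyapunov estimates and confinement -/

section Dynamics

variable {E : Type*} [NormedAddCommGroup E] [NormedSpace ℝ E]

/-- A continuous function that is positive on the zero set of a nonnegative function `q` in a
compact set is bounded below by a positive constant where `q` is small. -/
theorem exists_pos_le_of_small {X : Type*} [TopologicalSpace X] {A : Set X} (hA : IsCompact A)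
    {q g : X → ℝ} (hq : ContinuousOn q A) (hg : ContinuousOn g A) (hq0 : ∀ x ∈ A, 0 ≤ q x)
    (h : ∀ x ∈ A, q x = 0 → 0 < g x) :
    ∃ ρ > 0, ∃ c > 0, ∀ x ∈ A, q x < ρ → c ≤ g x := by
  rcases A.eq_empty_or_nonempty with rfl | hne
  · exact ⟨1, one_pos, 1, one_pos, by simp⟩
  -- The minimum of `max q g` is positive and serves as both constants: where `q` is below it, `g`
  -- must reach it.
  obtain ⟨a, ha, hmin⟩ := hA.exists_isMinOn (f := fun x => max (q x) (g x)) hne (hq.sup hg)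
  have hpos : 0 < max (q a) (g a) := by
    rcases (hq0 a ha).eq_or_lt with h0 | h0
    · exact lt_max_of_lt_right (h a ha h0.symm)
    · exact lt_max_of_lt_left h0
  refine ⟨_, hpos, _, hpos, fun x hx hqx => ?_⟩
  rcases le_max_iff.1 (isMinOn_iff.1 hmin x hx) with h1 | h1
  · exact absurd hqx h1.not_gt
  · exact h1

/-- A function with nonpositive one-sided derivatives on `[0, T]` does not increase. -/
theorem le_of_hasDerivWithinAt_nonpos {g g' : ℝ → ℝ} {T : ℝ} (hT : 0 ≤ T)
    (hg : ∀ t ∈ Icc 0 T, HasDerivWithinAt g (g' t) (Ici 0) t) (hg' : ∀ t ∈ Icc 0 T, g' t ≤ 0) :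
    g T ≤ g 0 := by
  have hd : ∀ t ∈ interior (Icc 0 T), HasDerivAt g (g' t) t := fun t ht => by
    rw [interior_Icc] at ht
    exact (hg t ⟨ht.1.le, ht.2.le⟩).hasDerivAt (Ici_mem_nhds ht.1)
  have := antitoneOn_of_deriv_nonpos (convex_Icc 0 T)
    (fun t ht => (hg t ht).continuousWithinAt.mono Icc_subset_Ici_self)
    (fun t ht => (hd t ht).differentiableAt.differentiableWithinAt)
    (fun t ht => by rw [(hd t ht).deriv]; exact hg' t (interior_subset ht))
  exact this ⟨le_rfl, hT⟩ ⟨hT, le_rfl⟩ hT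

/-- Local Lyapunov data for the field `V` at `e`: the distance function `q` to the constraint set
`{q = 0}` decays exponentially along the flow, and `f` decreases at rate `w` up to an error
controlled by `√q`. On the constraint set, `e` is a strict minimum of `f` and the only zero
of `w`. -/
structure IsCascadeLyapunov (V : E → E) (e : E) (f q w : E → ℝ) (ε lam M : ℝ) : Prop where
  eps_pos : 0 < ε
  lam_pos : 0 < lam
  M_nonneg : 0 ≤ M
  diff_f : Differentiable ℝ f
  diff_q : Differentiable ℝ q
  cont_w : Continuous w
  q_nonneg : ∀ x, 0 ≤ q x
  q_self : q e = 0
  q_decay : ∀ x ∈ Metric.closedBall e ε, fderiv ℝ q x (V x) ≤ -(2 * lam) * q x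
  w_nonneg : ∀ x, 0 ≤ w x
  f_decay : ∀ x ∈ Metric.closedBall e ε, fderiv ℝ f x (V x) ≤ -w x + lam * M * √(q x)
  f_pos : ∀ x ∈ Metric.closedBall e ε, q x = 0 → x ≠ e → f e < f x
  w_pos : ∀ x ∈ Metric.closedBall e ε, q x = 0 → x ≠ e → 0 < w x

namespace IsCascadeLyapunov

variable {V : E → E} {e : E} {f q w : E → ℝ} {ε lam M : ℝ}

theorem q_le (H : IsCascadeLyapunov V e f q w ε lam M) {y : ℝ → E} {T : ℝ} (hT : 0 ≤ T)
    (hy : ∀ t ∈ Icc 0 T, HasDerivWithinAt y (V (y t)) (Ici 0) t)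
    (hyB : ∀ t ∈ Icc 0 T, y t ∈ Metric.closedBall e ε) :
    q (y T) ≤ q (y 0) * Real.exp (-(2 * lam) * T) := by
  have key := le_of_hasDerivWithinAt_nonpos (g := fun t => q (y t) * Real.exp (2 * lam * t)) hT
    (fun t ht => ((H.diff_q (y t)).hasFDerivAt.comp_hasDerivWithinAt t (hy t ht)).mul
      (((hasDerivAt_id t).const_mul (2 * lam)).exp.hasDerivWithinAt))
    (fun t ht => by
      have := mul_le_mul_of_nonneg_right (H.q_decay _ (hyB t ht))
        (Real.exp_pos (2 * lam * t)).le
      simp only [id, Function.comp_apply]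
      linarith)
  simp only [mul_zero, Real.exp_zero, mul_one] at key
  rw [neg_mul, Real.exp_neg, ← div_eq_mul_inv, le_div_iff₀ (Real.exp_pos _)]
  exact key

/-- The error `λ M √q` integrates to at most `M √(q (y 0))`. The parameter `c` is `0` for
confinement and positive for attractivity. -/
theorem f_add_le (H : IsCascadeLyapunov V e f q w ε lam M) {y : ℝ → E} {T c : ℝ} (hT : 0 ≤ T)
    (hy : ∀ t ∈ Icc 0 T, HasDerivWithinAt y (V (y t)) (Ici 0) t)
    (hyB : ∀ t ∈ Icc 0 T, y t ∈ Metric.closedBall e ε) (hc : ∀ t ∈ Icc 0 T, c ≤ w (y t)) :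
    f (y T) + c * T ≤ f (y 0) + M * √(q (y 0)) := by
  have hsq : ∀ t ∈ Icc 0 T, √(q (y t)) ≤ √(q (y 0)) * Real.exp (-lam * t) := fun t ht => by
    have h1 := H.q_le ht.1 (fun s hs => hy s ⟨hs.1, hs.2.trans ht.2⟩)
      (fun s hs => hyB s ⟨hs.1, hs.2.trans ht.2⟩)
    refine (Real.sqrt_le_sqrt h1).trans_eq ?_
    rw [Real.sqrt_mul (H.q_nonneg _), show -(2 * lam) * t = -lam * t + -lam * t by ring,
      Real.exp_add, Real.sqrt_mul_self (Real.exp_pos _).le]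
  -- The derivative of the last summand cancels the bound on the error term in `f_decay`.
  have key := le_of_hasDerivWithinAt_nonpos
    (g := fun t => f (y t) + c * t + M * √(q (y 0)) * Real.exp (-lam * t)) hT
    (fun t ht => (((H.diff_f (y t)).hasFDerivAt.comp_hasDerivWithinAt t (hy t ht)).add
      ((hasDerivAt_id t).const_mul c).hasDerivWithinAt).add
      ((((hasDerivAt_id t).const_mul (-lam)).exp.hasDerivWithinAt).const_mul (M * √(q (y 0)))))
    (fun t ht => by
      have h1 := H.f_decay _ (hyB t ht)
      have h2 := mul_le_mul_of_nonneg_left (hsq t ht) (mul_nonneg H.lam_pos.le H.M_nonneg)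
      have h3 := hc t ht
      simp only [id]
      linarith)
  have h4 : 0 ≤ M * √(q (y 0)) * Real.exp (-lam * T) :=
    mul_nonneg (mul_nonneg H.M_nonneg (Real.sqrt_nonneg _)) (Real.exp_pos _).le
  simp only [mul_zero, Real.exp_zero, mul_one, add_zero] at key
  linarith

/-- Curves that follow `V` while they are near `e`, and start close enough to `e`, stay close
to `e`. -/
theorem exists_confined [ProperSpace E] (H : IsCascadeLyapunov V e f q w ε lam M) {r : ℝ}
    (hr : 0 < r) (hrε : r ≤ ε) :
    ∃ δ > 0, ∀ y : ℝ → E, ContinuousOn y (Ici 0) →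
      (∀ t ∈ Ici (0 : ℝ), y t ∈ Metric.closedBall e ε →
        HasDerivWithinAt y (V (y t)) (Ici 0) t) →
      ‖y 0 - e‖ < δ → ∀ t ≥ 0, ‖y t - e‖ < r := by
  obtain ⟨ρ, hρ, c, hc, hsph⟩ := exists_pos_le_of_small (isCompact_sphere e r)
    (q := q) (g := fun x => f x - f e) H.diff_q.continuous.continuousOn
    (H.diff_f.continuous.sub continuous_const).continuousOn (fun x _ => H.q_nonneg x)
    (fun x hx hqx => sub_pos.2 <| H.f_pos x
      (Metric.closedBall_subset_closedBall hrε (Metric.sphere_subset_closedBall hx)) hqx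
      (fun h => by subst h; simp at hx; linarith))
  have hqc := H.diff_q.continuous
  have h1 : ∀ᶠ x in 𝓝 e, q x < ρ := hqc.continuousAt.eventually_lt continuousAt_const
    (by rw [H.q_self]; exact hρ)
  have h2 : ∀ᶠ x in 𝓝 e, f x + M * √(q x) < f e + c :=
    ContinuousAt.eventually_lt (f := fun x => f x + M * √(q x))
      (H.diff_f.continuous.add (continuous_const.mul hqc.sqrt)).continuousAt continuousAt_const
      (by simp [H.q_self, hc])
  obtain ⟨δ, hδ, hball⟩ := Metric.eventually_nhds_iff.1 (h1.and h2)
  refine ⟨min δ r, lt_min hδ hr, fun y hyc hy hy0 t ht => ?_⟩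
  by_contra! hcon
  have hnc : ContinuousOn (fun s => ‖y s - e‖) (Icc 0 t) :=
    ((hyc.mono Icc_subset_Ici_self).sub continuousOn_const).norm
  have hcl : IsClosed (Icc 0 t ∩ (fun s => ‖y s - e‖) ⁻¹' Ici r) :=
    hnc.preimage_isClosed_of_isClosed isClosed_Icc isClosed_Ici
  -- `T` is the first time at which the curve reaches distance `r`.
  obtain ⟨T, ⟨hT, hTr⟩, hleast⟩ := (isCompact_Icc.of_isClosed_subset hcl
    inter_subset_left).exists_isLeast ⟨t, ⟨ht, le_rfl⟩, hcon⟩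
  have hbefore : ∀ s ∈ Icc 0 T, s ≠ T → ‖y s - e‖ < r := fun s hs hne => by
    by_contra! h
    exact hne (le_antisymm hs.2 (hleast ⟨⟨hs.1, hs.2.trans hT.2⟩, h⟩))
  have hTeq : ‖y T - e‖ = r := by
    obtain ⟨s, hs, hsr⟩ := intermediate_value_Icc hT.1
      (hnc.mono (Icc_subset_Icc_right hT.2))
      (show r ∈ Icc ‖y 0 - e‖ ‖y T - e‖ from ⟨(hy0.trans_le (min_le_right _ _)).le, hTr⟩)
    by_cases hsT : s = T
    · exact hsT ▸ hsr
    · exact absurd hsr (hbefore s hs hsT).ne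
  have hB : ∀ s ∈ Icc 0 T, y s ∈ Metric.closedBall e ε := fun s hs => by
    rw [mem_closedBall_iff_norm]
    by_cases hsT : s = T
    · rw [hsT, hTeq]; exact hrε
    · exact (hbefore s hs hsT).le.trans hrε
  have hd : ∀ s ∈ Icc 0 T, HasDerivWithinAt y (V (y s)) (Ici 0) s :=
    fun s hs => hy s hs.1 (hB s hs)
  obtain ⟨hq0, hf0⟩ := hball (by rw [dist_eq_norm]; exact hy0.trans_le (min_le_left _ _))
  have hqT : q (y T) < ρ := (H.q_le hT.1 hd hB).trans_lt <| hq0.trans_le' <|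
    mul_le_of_le_one_right (H.q_nonneg _) (Real.exp_le_one_iff.2 (by
      have := mul_nonneg H.lam_pos.le hT.1
      linarith))
  have hfT := H.f_add_le (c := 0) hT.1 hd hB (fun s _ => H.w_nonneg _)
  have := hsph (y T) (by rw [mem_sphere_iff_norm]; exact hTeq) hqT
  linarith

end IsCascadeLyapunov

/-! ### Global existence and uniqueness of solutions -/

/-- A bounded locally Lipschitz field on a finite-dimensional space has solutions on every
interval `[0, T]`. -/
theorem exists_hasDerivWithinAt_Icc_of_bounded [ProperSpace E] {W : E → E}
    (hW : LocallyLipschitz W) {L : NNReal} (hL : ∀ x, ‖W x‖ ≤ L) (x₀ : E) {T : ℝ} (hT : 0 ≤ T) :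
    ∃ y : ℝ → E, y 0 = x₀ ∧ ∀ t ∈ Icc 0 T, HasDerivWithinAt y (W (y t)) (Icc 0 T) t := by
  obtain ⟨K, hK⟩ := (hW.locallyLipschitzOn (s := Metric.closedBall x₀ (L * T))
    ).exists_lipschitzOnWith_of_compact (isCompact_closedBall _ _)
  lift T to NNReal using hT
  -- At speed at most `L`, no solution leaves the ball of radius `L * T` before time `T`.
  have : IsPicardLindelof (fun _ => W) (tmin := 0) (tmax := T) ⟨0, le_rfl, T.2⟩ x₀ (L * T) 0 L K :=
    IsPicardLindelof.of_time_independent (fun x _ => hL x) (by exact_mod_cast hK) (by simp)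
  exact this.exists_eq_forall_mem_Icc_hasDerivWithinAt₀

/-- Two solutions of a locally Lipschitz field with the same initial value agree. -/
theorem eqOn_Icc_of_locallyLipschitz [ProperSpace E] {W : E → E} (hW : LocallyLipschitz W)
    {y z : ℝ → E} {T : ℝ} (hy : ∀ t ∈ Icc 0 T, HasDerivWithinAt y (W (y t)) (Icc 0 T) t)
    (hz : ∀ t ∈ Icc 0 T, HasDerivWithinAt z (W (z t)) (Icc 0 T) t) (h0 : y 0 = z 0) :
    EqOn y z (Icc 0 T) := by
  have hyc : ContinuousOn y (Icc 0 T) := fun t ht => (hy t ht).continuousWithinAt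
  have hzc : ContinuousOn z (Icc 0 T) := fun t ht => (hz t ht).continuousWithinAt
  obtain ⟨K, hK⟩ := (hW.locallyLipschitzOn (s := y '' Icc 0 T ∪ z '' Icc 0 T)
    ).exists_lipschitzOnWith_of_compact
      ((isCompact_Icc.image_of_continuousOn hyc).union (isCompact_Icc.image_of_continuousOn hzc))
  refine ODE_solution_unique_of_mem_Icc_right (v := fun _ => W) (fun _ _ => hK) hyc
    (fun t ht => ?_) (fun t ht => Or.inl (mem_image_of_mem _ (Ico_subset_Icc_self ht))) hzc
    (fun t ht => ?_) (fun t ht => Or.inr (mem_image_of_mem _ (Ico_subset_Icc_self ht))) h0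
  · exact (hy t (Ico_subset_Icc_self ht)).mono_of_mem_nhdsWithin
      (mem_of_superset (Icc_mem_nhdsGE ht.2) (Icc_subset_Icc_left ht.1))
  · exact (hz t (Ico_subset_Icc_self ht)).mono_of_mem_nhdsWithin
      (mem_of_superset (Icc_mem_nhdsGE ht.2) (Icc_subset_Icc_left ht.1))

/-- A bounded locally Lipschitz field on a finite-dimensional space is forward complete. -/
theorem exists_isSolution_of_bounded [ProperSpace E] {W : E → E}
    (hW : LocallyLipschitz W) {L : NNReal} (hL : ∀ x, ‖W x‖ ≤ L) (x₀ : E) :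
    ∃ y : ℝ → E, IsSolution W y ∧ y 0 = x₀ := by
  choose y hy0 hy using fun n : ℕ =>
    exists_hasDerivWithinAt_Icc_of_bounded hW hL x₀ (T := n) n.cast_nonneg
  have hmono : ∀ {m n : ℕ}, m ≤ n → EqOn (y m) (y n) (Icc 0 m) := fun {m n} hmn =>
    have hsub : Icc (0 : ℝ) m ⊆ Icc 0 n := Icc_subset_Icc_right (by exact_mod_cast hmn)
    eqOn_Icc_of_locallyLipschitz hW (hy m) (fun t ht => (hy n t (hsub ht)).mono hsub)
      ((hy0 m).trans (hy0 n).symm)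
  -- The solutions on `[0, n]` are glued by using at time `t` the one with index `⌈t⌉₊`.
  have heq : ∀ n : ℕ, EqOn (fun t => y ⌈t⌉₊ t) (y n) (Icc 0 n) := fun n t ht =>
    hmono (Nat.ceil_le.2 ht.2) ⟨ht.1, Nat.le_ceil t⟩
  refine ⟨fun t => y ⌈t⌉₊ t, fun t ht => ?_, by simp [hy0]⟩
  obtain ⟨n, hn⟩ := exists_nat_gt t
  have h1 : HasDerivWithinAt (fun t => y ⌈t⌉₊ t) (W (y n t)) (Icc 0 n) t :=
    (hy n t ⟨ht, hn.le⟩).congr (heq n) (heq n ⟨ht, hn.le⟩)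
  rw [← heq n ⟨ht, hn.le⟩] at h1
  refine h1.mono_of_mem_nhdsWithin ?_
  have := inter_mem_nhdsWithin (Ici (0 : ℝ)) (Iic_mem_nhds hn)
  exact mem_of_superset this (fun s hs => ⟨hs.1, hs.2⟩)

/-- A locally Lipschitz field agrees near `e` with a bounded locally Lipschitz field. -/
theorem exists_bounded_locallyLipschitz_eqOn [FiniteDimensional ℝ E] {V : E → E}
    (hV : LocallyLipschitz V) (e : E) {r : ℝ} (hr : 0 < r) :
    ∃ W : E → E, LocallyLipschitz W ∧ (∃ L : NNReal, ∀ x, ‖W x‖ ≤ L) ∧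
      EqOn W V (Metric.closedBall e r) := by
  have : ProperSpace E := FiniteDimensional.proper ℝ E
  let χ : ContDiffBump e := ⟨r, r + 1, hr, by linarith⟩
  have hW : LocallyLipschitz fun x => χ x • V x :=
    (contDiff_fst.smul contDiff_snd : ContDiff ℝ 1 fun z : ℝ × E => z.1 • z.2).locallyLipschitz.comp
      ((χ.contDiff (n := 1)).locallyLipschitz.prodMk hV)
  refine ⟨_, hW, ?_, fun x hx => by simp [χ.one_of_mem_closedBall hx]⟩
  obtain ⟨C, hC⟩ := hW.continuous.bounded_above_of_compact_support χ.hasCompactSupport.smul_right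
  exact ⟨⟨max C 0, le_max_right _ _⟩, fun x => (hC x).trans (le_max_left _ _)⟩

theorem IsSolution.shift {V : E → E} {x : ℝ → E} (hx : IsSolution V x) {a : ℝ} (ha : 0 ≤ a) :
    IsSolution V (fun s => x (a + s)) := fun t ht => by
  have h := (hx (a + t) (add_nonneg ha ht)).scomp t
    (((hasDerivAt_id t).const_add a).hasDerivWithinAt (s := Ici 0))
    (fun s hs => add_nonneg ha hs)
  simpa [Function.comp_def] using h

/-! ### Stability and attractivity from the Lyapunov data -/

namespace IsCascadeLyapunov

variable {V : E → E} {e : E} {f q w : E → ℝ} {ε lam M : ℝ}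

theorem isStable [FiniteDimensional ℝ E] (H : IsCascadeLyapunov V e f q w ε lam M)
    (hV : LocallyLipschitz V) : IsStable V e := by
  have : ProperSpace E := FiniteDimensional.proper ℝ E
  intro r hr
  obtain ⟨δ, hδ, hconf⟩ := H.exists_confined (lt_min hr H.eps_pos) (min_le_right r ε)
  refine ⟨δ, hδ, fun x₀ hx₀ => ⟨?_, fun x hx hx0 t ht => ?_⟩⟩
  · obtain ⟨W, hW, ⟨L, hL⟩, hWV⟩ := exists_bounded_locallyLipschitz_eqOn hV e H.eps_pos
    obtain ⟨y, hy, hy0⟩ := exists_isSolution_of_bounded hW hL x₀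
    -- Confinement only needs `y` to follow `V` inside the ball, where `W = V`. It then keeps `y`
    -- there, so `y` solves the original system.
    have hin := hconf y (fun t ht => (hy t ht).continuousWithinAt)
      (fun t ht htB => hWV htB ▸ hy t ht) (hy0 ▸ hx₀)
    refine ⟨y, fun t ht => ?_, hy0⟩
    rw [← hWV (mem_closedBall_iff_norm.2 ((hin t ht).le.trans (min_le_right _ _)))]
    exact hy t ht
  · exact (hconf x (fun t ht => (hx t ht).continuousWithinAt) (fun t ht _ => hx t ht)
      (hx0 ▸ hx₀) t ht).trans_le (min_le_left _ _)

/-- A solution that stays near `e` comes arbitrarily close to `e`. -/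
theorem exists_norm_sub_lt [ProperSpace E] (H : IsCascadeLyapunov V e f q w ε lam M)
    {x : ℝ → E} (hx : IsSolution V x) (hxB : ∀ t ≥ 0, x t ∈ Metric.closedBall e ε) {r : ℝ}
    (hr : 0 < r) : ∃ t ≥ 0, ‖x t - e‖ < r := by
  by_contra! hcon
  have hB := isCompact_closedBall e ε
  obtain ⟨ρ, hρ, c, hc, hA⟩ := exists_pos_le_of_small
    (hB.diff (Metric.isOpen_ball (x := e) (ε := r))) (q := q) (g := w)
    H.diff_q.continuous.continuousOn H.cont_w.continuousOn
    (fun x _ => H.q_nonneg x)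
    (fun x hx hqx => H.w_pos x hx.1 hqx (fun h => hx.2 (h ▸ Metric.mem_ball_self hr)))
  have hxA : ∀ t ≥ 0, x t ∈ Metric.closedBall e ε \ Metric.ball e r := fun t ht =>
    ⟨hxB t ht, fun h => (hcon t ht).not_gt (mem_ball_iff_norm.1 h)⟩
  have hlim : Tendsto (fun t => q (x 0) * Real.exp (-(2 * lam) * t)) atTop (𝓝 0) := by
    have h1 : Tendsto (fun t => -(2 * lam) * t) atTop atBot :=
      tendsto_id.const_mul_atTop_of_neg (by linarith [H.lam_pos])
    simpa using (Real.tendsto_exp_atBot.comp h1).const_mul (q (x 0))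
  obtain ⟨a, ha⟩ := eventually_atTop.1 ((hlim.eventually_lt_const hρ).and (eventually_ge_atTop 0))
  have hqx : ∀ t ≥ a, q (x t) < ρ := fun t ht => (H.q_le (ha t ht).2
    (fun s hs => hx s hs.1) (fun s hs => hxB s hs.1)).trans_lt (ha t ht).1
  have ha0 : 0 ≤ a := (ha a le_rfl).2
  have hfa : ∀ T ≥ 0, f (x (a + T)) + c * T ≤ f (x a) + M * √(q (x a)) := fun T hT => by
    have := H.f_add_le hT (fun s hs => hx.shift ha0 s hs.1)
      (fun s hs => hxB _ (add_nonneg ha0 hs.1)) (c := c)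
      (fun s hs => hA _ (hxA _ (add_nonneg ha0 hs.1)) (hqx _ (le_add_of_nonneg_right hs.1)))
    simpa using this
  obtain ⟨m, hm⟩ := (hB.image H.diff_f.continuous).bddBelow
  have hT : 0 ≤ (f (x a) + M * √(q (x a)) - m) / c := div_nonneg (by
    linarith [hm (mem_image_of_mem f (hxB a ha0)),
      mul_nonneg H.M_nonneg (Real.sqrt_nonneg (q (x a)))]) hc.le
  -- At this time after `a`, the value of `f` would be at most `m - c`, below its lower bound `m` on
  -- the ball.
  have h1 := hfa ((f (x a) + M * √(q (x a)) - m) / c + 1) (by linarith)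
  have h2 := hm (mem_image_of_mem f (hxB (a + ((f (x a) + M * √(q (x a)) - m) / c + 1))
    (by linarith)))
  rw [mul_add, mul_div_cancel₀ _ hc.ne'] at h1
  linarith

theorem isAsymptoticallyStable [FiniteDimensional ℝ E]
    (H : IsCascadeLyapunov V e f q w ε lam M) (hV : LocallyLipschitz V) (he : V e = 0) :
    IsAsymptoticallyStable V e := by
  have : ProperSpace E := FiniteDimensional.proper ℝ E
  have hst := H.isStable hV
  refine ⟨he, hst, ?_⟩
  obtain ⟨δ, hδ, hconf⟩ := H.exists_confined H.eps_pos le_rfl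
  refine ⟨δ, hδ, fun x hx hx0 => Metric.tendsto_atTop.2 fun r hr => ?_⟩
  obtain ⟨η, hη, hηs⟩ := hst r hr
  obtain ⟨a, ha, hax⟩ := H.exists_norm_sub_lt hx (fun t ht => mem_closedBall_iff_norm.2
    (hconf x (fun t ht => (hx t ht).continuousWithinAt) (fun t ht _ => hx t ht) hx0 t ht).le) hη
  refine ⟨a, fun t ht => ?_⟩
  have := (hηs (x a) hax).2 _ (hx.shift ha) (by simp) (t - a) (sub_nonneg.2 ht)
  simpa [dist_eq_norm] using this

end IsCascadeLyapunov

end Dynamics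


/-! ### Calculus of the constraint defect -/

section MatrixCalculus

variable {l m n p : ℕ}

theorem frobenius_inner_eq (X Y : Matrix (Fin n) (Fin p) ℝ) : inner ℝ X Y = (Xᵀ * Y).trace := rfl

theorem isBoundedBilinearMap_matrix_mul :
    IsBoundedBilinearMap ℝ
      (fun z : Matrix (Fin l) (Fin m) ℝ × Matrix (Fin m) (Fin n) ℝ => z.1 * z.2) where
  add_left := Matrix.add_mul
  smul_left := Matrix.smul_mul
  add_right := Matrix.mul_add
  smul_right c X Y := Matrix.mul_smul X c Y
  bound := ⟨1, one_pos, fun X Y => by simpa using Matrix.frobenius_norm_mul X Y⟩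

theorem isBoundedLinearMap_transpose :
    IsBoundedLinearMap ℝ (fun X : Matrix (Fin n) (Fin p) ℝ => Xᵀ) where
  map_add := Matrix.transpose_add
  map_smul := Matrix.transpose_smul
  bound := ⟨1, one_pos, fun X => by rw [Matrix.frobenius_norm_transpose, one_mul]⟩

/-- The product of a skew-symmetric and a symmetric matrix has trace zero. -/
theorem trace_mul_eq_zero_of_skew_of_symm {K S : Matrix (Fin n) (Fin n) ℝ} (hK : Kᵀ = -K)
    (hS : Sᵀ = S) : (K * S).trace = 0 := by
  have h : (K * S).trace = -(K * S).trace := by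
    conv_lhs => rw [← Matrix.trace_transpose, Matrix.transpose_mul, hK, hS, Matrix.mul_neg,
      Matrix.trace_neg, Matrix.trace_mul_comm]
  linarith

/-- The constraint defect `Xᵀ X - I`. -/
def defect (X : Matrix (Fin n) (Fin p) ℝ) : Matrix (Fin p) (Fin p) ℝ := Xᵀ * X - 1

theorem transpose_defect (X : Matrix (Fin n) (Fin p) ℝ) : (defect X)ᵀ = defect X := by
  simp [defect]

theorem mem_stiefel_iff_defect {X : Matrix (Fin n) (Fin p) ℝ} :
    X ∈ stiefel n p ↔ defect X = 0 := sub_eq_zero.symm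

theorem hasFDerivAt_norm_defect_sq (X : Matrix (Fin n) (Fin p) ℝ) :
    HasFDerivAt (fun X : Matrix (Fin n) (Fin p) ℝ => ‖defect X‖ ^ 2)
      ((4 : ℝ) • innerSL ℝ (X * defect X)) X := by
  have h1 : HasFDerivAt (fun X : Matrix (Fin n) (Fin p) ℝ => (Xᵀ, X)) _ X :=
    (isBoundedLinearMap_transpose.hasFDerivAt (x := X)).prodMk (hasFDerivAt_id X)
  have h2 := ((HasFDerivAt.comp (f := fun X : Matrix (Fin n) (Fin p) ℝ => (Xᵀ, X)) X
    ((isBoundedBilinearMap_matrix_mul (l := p) (m := n) (n := p)).hasFDerivAt (Xᵀ, X))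
    h1).sub_const 1).norm_sq
  refine h2.congr_fderiv ?_
  ext ξ
  have hR := transpose_defect X
  have : inner ℝ (defect X) (Xᵀ * ξ + ξᵀ * X) = 2 * inner ℝ (X * defect X) ξ := by
    simp only [frobenius_inner_eq, Matrix.mul_add, Matrix.trace_add, Matrix.transpose_mul, hR]
    rw [← Matrix.trace_transpose (defect X * (ξᵀ * X))]
    simp only [Matrix.transpose_mul, Matrix.transpose_transpose, hR]
    rw [Matrix.trace_mul_comm (Xᵀ * ξ)]
    simp only [Matrix.mul_assoc]
    ring
  have h3 : (2 : ℕ) • inner ℝ (defect X) (Xᵀ * ξ + ξᵀ * X) = 4 * inner ℝ (X * defect X) ξ := by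
    rw [this, two_nsmul]; ring
  exact h3

theorem gradient_penalty (X : Matrix (Fin n) (Fin p) ℝ) :
    ∇ (penalty (n := n) (p := p)) X = X * defect X := by
  refine HasGradientAt.gradient (hasGradientAt_iff_hasFDerivAt.2 ?_)
  refine ((hasFDerivAt_norm_defect_sq X).const_mul (1 / 4 : ℝ)).congr_fderiv ?_
  ext ξ
  simp

/-- With `R = defect X`, `‖X R‖² = tr(R (I + R) R) ≥ ‖R‖² (1 - ‖R‖)`. -/
theorem half_norm_defect_sq_le {X : Matrix (Fin n) (Fin p) ℝ} (hX : ‖defect X‖ ≤ 1 / 2) :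
    1 / 2 * ‖defect X‖ ^ 2 ≤ ‖X * defect X‖ ^ 2 := by
  set R := defect X with hRdef
  have hR : Rᵀ = R := transpose_defect X
  have hS : Xᵀ * X = R + 1 := by simp [hRdef, defect]
  have h1 : ‖X * R‖ ^ 2 = ‖R‖ ^ 2 + inner ℝ R (R * R) := by
    rw [← real_inner_self_eq_norm_sq, ← real_inner_self_eq_norm_sq]
    simp only [frobenius_inner_eq, Matrix.transpose_mul, hR]
    rw [Matrix.mul_assoc, ← Matrix.mul_assoc Xᵀ, hS, Matrix.add_mul, Matrix.one_mul,
      Matrix.mul_add, Matrix.trace_add, add_comm]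
  have h2 : |inner ℝ R (R * R)| ≤ ‖R‖ * (‖R‖ * ‖R‖) :=
    (abs_real_inner_le_norm _ _).trans
      (mul_le_mul_of_nonneg_left (Matrix.frobenius_norm_mul R R) (norm_nonneg R))
  have h3 := mul_le_mul_of_nonneg_right hX (mul_self_nonneg ‖R‖)
  have h4 := neg_le_of_abs_le h2
  rw [h1]
  linarith [sq ‖R‖]

end MatrixCalculus

/-! ### The field `ψ` and relative critical points -/

theorem fderiv_eq_inner_gradient {E : Type*} [NormedAddCommGroup E] [InnerProductSpace ℝ E]
    [CompleteSpace E] {f : E → ℝ} (hf : Differentiable ℝ f) (x v : E) :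
    fderiv ℝ f x v = inner ℝ (∇ f x) v := by
  rw [(hasGradientAt_iff_hasFDerivAt.1 (hf x).hasGradientAt).fderiv,
    InnerProductSpace.toDual_apply_apply]

variable {n p : ℕ} {f : Matrix (Fin n) (Fin p) ℝ → ℝ}

theorem psi_eq (X : Matrix (Fin n) (Fin p) ℝ) : psi f X = ∇ f X * Xᵀ - X * (∇ f X)ᵀ := by
  simp [psi, skewPart, smul_smul]

theorem transpose_psi (X : Matrix (Fin n) (Fin p) ℝ) : (psi f X)ᵀ = -psi f X := by
  simp [psi_eq]

theorem landingField_eq (lam : ℝ) (X : Matrix (Fin n) (Fin p) ℝ) :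
    landingField f lam X = psi f X * X + lam • (X * defect X) := by
  rw [landingField, gradient_penalty]

/-- Pairing with the skew `ψ` kills the symmetric part of `∇f Xᵀ`, and the skew part is `ψ / 2`. -/
theorem inner_gradient_psi_mul (X : Matrix (Fin n) (Fin p) ℝ) :
    inner ℝ (∇ f X) (psi f X * X) = 1 / 2 * ‖psi f X‖ ^ 2 := by
  have h1 : inner ℝ (∇ f X) (psi f X * X) = (psi f X * (X * (∇ f X)ᵀ)).trace := by
    rw [frobenius_inner_eq, Matrix.trace_mul_comm, Matrix.mul_assoc]
  have h2 : (psi f X * (∇ f X * Xᵀ)).trace = -(psi f X * (X * (∇ f X)ᵀ)).trace := by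
    have := trace_mul_eq_zero_of_skew_of_symm (transpose_psi (f := f) X)
      (S := ∇ f X * Xᵀ + X * (∇ f X)ᵀ) (by simp [add_comm])
    rw [Matrix.mul_add, Matrix.trace_add] at this
    linarith
  have h3 : ‖psi f X‖ ^ 2 = -(psi f X * psi f X).trace := by
    rw [← real_inner_self_eq_norm_sq, frobenius_inner_eq, transpose_psi, Matrix.neg_mul,
      Matrix.trace_neg]
  have h4 : (psi f X * psi f X).trace =
      (psi f X * (∇ f X * Xᵀ)).trace - (psi f X * (X * (∇ f X)ᵀ)).trace := by
    rw [← Matrix.trace_sub, ← Matrix.mul_sub, ← psi_eq]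
  rw [h1, h3, h4, h2]
  ring

theorem inner_mul_defect_psi_mul (X : Matrix (Fin n) (Fin p) ℝ) :
    inner ℝ (X * defect X) (psi f X * X) = 0 := by
  rw [frobenius_inner_eq, Matrix.trace_mul_comm, Matrix.mul_assoc]
  exact trace_mul_eq_zero_of_skew_of_symm (transpose_psi X)
    (by simp [transpose_defect, Matrix.mul_assoc])

theorem psi_eq_zero_of_mem_criticalPoints (hf : Differentiable ℝ f)
    {X : Matrix (Fin n) (Fin p) ℝ} (hX : X ∈ criticalPoints f) : psi f X = 0 := by
  have h := hX.2 (psi f X * X) (by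
    simp [tangentSpace, Matrix.transpose_mul, transpose_psi, Matrix.mul_assoc])
  have h' := (fderiv_eq_inner_gradient hf X (psi f X * X)).symm.trans h
  rw [inner_gradient_psi_mul] at h'
  simpa using h'

theorem mem_criticalPoints_of_psi_eq_zero (hf : Differentiable ℝ f)
    {X : Matrix (Fin n) (Fin p) ℝ} (hX : X ∈ stiefel n p) (h : psi f X = 0) :
    X ∈ criticalPoints f := by
  refine ⟨hX, fun ξ hξ => ?_⟩
  have hX1 : Xᵀ * X = 1 := hX
  rw [psi_eq, sub_eq_zero] at h
  -- The gradient is `X` times a symmetric matrix, that is, normal to the manifold.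
  have hG : ∇ f X = X * ((∇ f X)ᵀ * X) := by
    rw [← Matrix.mul_assoc, ← h, Matrix.mul_assoc, hX1, Matrix.mul_one]
  have hsymm : ((∇ f X)ᵀ * X)ᵀ = (∇ f X)ᵀ * X := by
    rw [Matrix.transpose_mul, Matrix.transpose_transpose]
    conv_lhs => rw [hG]
    rw [← Matrix.mul_assoc, hX1, Matrix.one_mul]
  have hskew : (Xᵀ * ξ)ᵀ = -(Xᵀ * ξ) := by
    rw [Matrix.transpose_mul, Matrix.transpose_transpose]
    exact eq_neg_of_add_eq_zero_left hξ
  refine (fderiv_eq_inner_gradient hf X ξ).trans ?_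
  rw [frobenius_inner_eq, hG, Matrix.transpose_mul, hsymm, Matrix.mul_assoc,
    Matrix.trace_mul_comm]
  exact trace_mul_eq_zero_of_skew_of_symm hskew hsymm

attribute [local instance] Matrix.frobeniusNormedRing Matrix.frobeniusNormedAlgebra in
theorem hasDerivAt_exp_smul_mul (K : Matrix (Fin n) (Fin n) ℝ) (X : Matrix (Fin n) (Fin p) ℝ) :
    HasDerivAt (fun t : ℝ => NormedSpace.exp (t • K) * X) (K * X) 0 := by
  have h := hasDerivAt_exp_smul_const (𝕂 := ℝ) K (0 : ℝ)
  have h2 := (isBoundedBilinearMap_matrix_mul (l := n) (m := n) (n := p)).isBoundedLinearMap_left X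
  refine ((h2.hasFDerivAt (x := NormedSpace.exp ((0 : ℝ) • K))).comp_hasDerivAt (0 : ℝ)
    h).congr_deriv ?_
  change NormedSpace.exp ((0 : ℝ) • K) * K * X = _
  simp

theorem exp_smul_mul_mem_stiefel {K : Matrix (Fin n) (Fin n) ℝ} (hK : Kᵀ = -K)
    {X : Matrix (Fin n) (Fin p) ℝ} (hX : X ∈ stiefel n p) (t : ℝ) :
    NormedSpace.exp (t • K) * X ∈ stiefel n p := by
  have h : (NormedSpace.exp (t • K))ᵀ * NormedSpace.exp (t • K) = 1 := by
    rw [← Matrix.exp_transpose, Matrix.transpose_smul, hK, smul_neg, Matrix.exp_neg]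
    exact Matrix.nonsing_inv_mul _ ((Matrix.isUnit_iff_isUnit_det _).1 (Matrix.isUnit_exp _))
  change _ = _
  rw [Matrix.transpose_mul, Matrix.mul_assoc, ← Matrix.mul_assoc _ _ X, h, Matrix.one_mul]
  exact hX

/-- The curve `exp(t ψ) X` stays on the manifold with initial velocity `ψ X`, along which `f` has
derivative `½‖ψ‖²`. -/
theorem psi_eq_zero_of_isLocalMinOn (hf : Differentiable ℝ f)
    {X : Matrix (Fin n) (Fin p) ℝ} (hX : X ∈ stiefel n p) (hmin : IsLocalMinOn f (stiefel n p) X) :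
    psi f X = 0 := by
  have hd := hasDerivAt_exp_smul_mul (psi f X) X
  have h0 : NormedSpace.exp ((0 : ℝ) • psi f X) * X = X := by simp
  have ht : Tendsto (fun t : ℝ => NormedSpace.exp (t • psi f X) * X) (𝓝 0)
      (𝓝[stiefel n p] X) :=
    tendsto_nhdsWithin_iff.2 ⟨by
      have h := hd.continuousAt.tendsto
      simp only [h0] at h
      exact h,
      Eventually.of_forall (exp_smul_mul_mem_stiefel (transpose_psi X) hX)⟩
  have hloc : IsLocalMin (fun t : ℝ => f (NormedSpace.exp (t • psi f X) * X)) 0 := by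
    filter_upwards [ht.eventually hmin] with t h
    simpa [h0] using h
  have hfd : HasFDerivAt f (fderiv ℝ f X) (NormedSpace.exp ((0 : ℝ) • psi f X) * X) :=
    h0.symm ▸ (hf X).hasFDerivAt
  have h := hloc.hasDerivAt_eq_zero (hfd.comp_hasDerivAt (0 : ℝ) hd)
  have h' := (fderiv_eq_inner_gradient hf X (psi f X * X)).symm.trans h
  rw [inner_gradient_psi_mul] at h'
  simpa using h'

/-! ### Local Lipschitz continuity of the landing field -/

theorem locallyLipschitz_comp_of_isBoundedBilinearMap {X E F G : Type*} [PseudoEMetricSpace X]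
    [NormedAddCommGroup E] [NormedSpace ℝ E] [NormedAddCommGroup F] [NormedSpace ℝ F]
    [NormedAddCommGroup G] [NormedSpace ℝ G] {b : E × F → G} (hb : IsBoundedBilinearMap ℝ b)
    {A : X → E} {B : X → F} (hA : LocallyLipschitz A) (hB : LocallyLipschitz B) :
    LocallyLipschitz fun x => b (A x, B x) :=
  (hb.contDiff (n := 1)).locallyLipschitz.comp (hA.prodMk hB)

theorem locallyLipschitz_matrix_mul {l m k : ℕ}
    {A : Matrix (Fin n) (Fin p) ℝ → Matrix (Fin l) (Fin m) ℝ}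
    {B : Matrix (Fin n) (Fin p) ℝ → Matrix (Fin m) (Fin k) ℝ} (hA : LocallyLipschitz A)
    (hB : LocallyLipschitz B) : LocallyLipschitz fun X => A X * B X :=
  locallyLipschitz_comp_of_isBoundedBilinearMap isBoundedBilinearMap_matrix_mul hA hB

theorem locallyLipschitz_transpose :
    LocallyLipschitz (fun X : Matrix (Fin n) (Fin p) ℝ => Xᵀ) :=
  (isBoundedLinearMap_transpose.contDiff (n := 1)).locallyLipschitz

theorem locallyLipschitz_sub {E F : Type*} [PseudoEMetricSpace E] [NormedAddCommGroup F]
    [NormedSpace ℝ F] {A B : E → F} (hA : LocallyLipschitz A) (hB : LocallyLipschitz B) :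
    LocallyLipschitz fun x => A x - B x :=
  (contDiff_fst.sub contDiff_snd : ContDiff ℝ 1 fun z : F × F => z.1 - z.2).locallyLipschitz.comp
    (hA.prodMk hB)

theorem locallyLipschitz_psi (hf : LocallyLipschitz (∇ f)) : LocallyLipschitz (psi f) := by
  rw [funext (psi_eq (f := f))]
  exact locallyLipschitz_sub (locallyLipschitz_matrix_mul hf locallyLipschitz_transpose)
    (locallyLipschitz_matrix_mul LocallyLipschitz.id (locallyLipschitz_transpose.comp hf))

theorem locallyLipschitz_neg_landingField (hf : LocallyLipschitz (∇ f)) (lam : ℝ) :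
    LocallyLipschitz fun X => -landingField f lam X := by
  have h : (fun X => -landingField f lam X) =
      fun X => -lam • (X * (Xᵀ * X - 1)) - psi f X * X := by
    funext X
    rw [landingField_eq, defect, neg_smul]
    abel
  rw [h]
  refine locallyLipschitz_sub ?_ (locallyLipschitz_matrix_mul (locallyLipschitz_psi hf)
    LocallyLipschitz.id)
  exact ((contDiff_id.const_smul (-lam) : ContDiff ℝ 1 fun Y : Matrix (Fin n) (Fin p) ℝ =>
    -lam • Y).locallyLipschitz).comp (locallyLipschitz_matrix_mul LocallyLipschitz.id
      (locallyLipschitz_sub (locallyLipschitz_matrix_mul locallyLipschitz_transpose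
        LocallyLipschitz.id) (LocallyLipschitz.const 1)))

theorem continuous_defect : Continuous (defect (n := n) (p := p)) :=
  (locallyLipschitz_sub (locallyLipschitz_matrix_mul locallyLipschitz_transpose
        LocallyLipschitz.id) (LocallyLipschitz.const 1)).continuous

/-! ### Lyapunov data for the landing flow -/

/-- Near a strict local minimum that is an isolated critical point, `f` is a Lyapunov function of
the landing flow up to the exponentially decaying constraint defect. -/
theorem exists_isCascadeLyapunov (hf : ContDiff ℝ 1 f) (hf_lip : LocallyLipschitz (∇ f))
    {lam : ℝ} (hlam : 0 < lam) {Xs : Matrix (Fin n) (Fin p) ℝ}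
    (hmin : IsLocalMinOn f (stiefel n p) Xs) (hcrit : IsIsolatedCriticalPoint f Xs) :
    ∃ ε M, IsCascadeLyapunov (fun X => -landingField f lam X) Xs f (fun X => ‖defect X‖ ^ 2)
      (fun X => 1 / 2 * ‖psi f X‖ ^ 2) ε lam M := by
  have hd : Differentiable ℝ f := hf.differentiable one_ne_zero
  obtain ⟨hXs, ε₁, hε₁, hiso⟩ := hcrit
  obtain ⟨ε₂, hε₂, hmin'⟩ := Metric.eventually_nhds_iff.1 (eventually_nhdsWithin_iff.1 hmin)
  have hnear : ∀ᶠ X in 𝓝 Xs, ‖defect X‖ < 1 / 2 :=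
    continuous_defect.norm.continuousAt.eventually_lt continuousAt_const
      (by simp [mem_stiefel_iff_defect.1 hXs.1])
  obtain ⟨ε₃, hε₃, hdef⟩ := Metric.eventually_nhds_iff.1 hnear
  have hmpos : 0 < min ε₁ (min ε₂ ε₃) := lt_min hε₁ (lt_min hε₂ hε₃)
  set ε := min ε₁ (min ε₂ ε₃) / 2 with hε
  have hεpos : 0 < ε := half_pos hmpos
  have hlt : ∀ X ∈ Metric.closedBall Xs ε, dist X Xs < ε₁ ∧ dist X Xs < ε₂ ∧ dist X Xs < ε₃ :=
    fun X hX => by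
      have h : dist X Xs < min ε₁ (min ε₂ ε₃) := (Metric.mem_closedBall.1 hX).trans_lt
        (half_lt_self hmpos)
      exact ⟨(lt_min_iff.1 h).1, (lt_min_iff.1 (lt_min_iff.1 h).2)⟩
  have hw : ∀ X ∈ Metric.closedBall Xs ε, X ∈ stiefel n p → X ≠ Xs → psi f X ≠ 0 :=
    fun X hX hXst hne h0 => hne <| hiso X (mem_criticalPoints_of_psi_eq_zero hd hXst h0)
      (dist_eq_norm X Xs ▸ (hlt X hX).1)
  have : ProperSpace (Matrix (Fin n) (Fin p) ℝ) := FiniteDimensional.proper ℝ _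
  obtain ⟨M, hM⟩ := ((isCompact_closedBall Xs ε).image
    (hf_lip.continuous.norm.mul continuous_norm)).bddAbove
  have hMle : ∀ X ∈ Metric.closedBall Xs ε, ‖∇ f X‖ * ‖X‖ ≤ M :=
    fun X hX => hM (mem_image_of_mem (fun X => ‖∇ f X‖ * ‖X‖) hX)
  have hmem : ∀ X : Matrix (Fin n) (Fin p) ℝ, ‖defect X‖ ^ 2 = 0 → X ∈ stiefel n p :=
    fun X h => mem_stiefel_iff_defect.2 (by simpa using h)
  refine ⟨ε, M, hεpos, hlam,
    (mul_nonneg (norm_nonneg _) (norm_nonneg _)).trans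
      (hMle Xs (Metric.mem_closedBall_self hεpos.le)),
    hd, fun X => (hasFDerivAt_norm_defect_sq X).differentiableAt,
    continuous_const.mul ((locallyLipschitz_psi hf_lip).continuous.norm.pow 2),
    fun X => sq_nonneg _, by simp [mem_stiefel_iff_defect.1 hXs.1], fun X hX => ?_,
    fun X => by positivity, fun X hX => ?_, fun X hX hq hne => ?_, fun X hX hq hne => ?_⟩
  · have h := mul_le_mul_of_nonneg_left (half_norm_defect_sq_le (hdef (hlt X hX).2.2).le) hlam.le
    refine (DFunLike.congr_fun (hasFDerivAt_norm_defect_sq X).fderiv _).trans_le ?_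
    have h2 : (4 : ℝ) * inner ℝ (X * defect X) (-landingField f lam X) =
        -4 * (lam * ‖X * defect X‖ ^ 2) := by
      rw [landingField_eq, inner_neg_right, inner_add_right, inner_smul_right, inner_mul_defect_psi_mul,
        real_inner_self_eq_norm_sq]
      ring
    refine h2.trans_le ?_
    linarith
  · refine (fderiv_eq_inner_gradient hd X _).trans_le ?_
    rw [landingField_eq, inner_neg_right, inner_add_right, inner_smul_right,
      inner_gradient_psi_mul, Real.sqrt_sq (norm_nonneg _)]
    have h1 : -inner ℝ (∇ f X) (X * defect X) ≤ M * ‖defect X‖ :=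
      calc -inner ℝ (∇ f X) (X * defect X) ≤ ‖∇ f X‖ * ‖X * defect X‖ :=
            (neg_le_abs _).trans (abs_real_inner_le_norm _ _)
        _ ≤ ‖∇ f X‖ * (‖X‖ * ‖defect X‖) :=
            mul_le_mul_of_nonneg_left (Matrix.frobenius_norm_mul _ _) (norm_nonneg _)
        _ ≤ M * ‖defect X‖ := by
            rw [← mul_assoc]
            exact mul_le_mul_of_nonneg_right (hMle X hX) (norm_nonneg _)
    have h2 := mul_le_mul_of_nonneg_left h1 hlam.le
    linarith
  · have hXst := hmem X hq
    have hle : f Xs ≤ f X := hmin' (hlt X hX).2.1 hXst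
    -- If `f X = f Xs`, then `X` is itself a local minimum on the manifold, so `ψ` vanishes there,
    -- against `hw`.
    refine hle.lt_of_ne fun heq => hw X hX hXst hne (psi_eq_zero_of_isLocalMinOn hd hXst ?_)
    have hU : Metric.ball Xs ε₂ ∈ 𝓝 X := Metric.isOpen_ball.mem_nhds (hlt X hX).2.1
    filter_upwards [mem_nhdsWithin_of_mem_nhds hU, self_mem_nhdsWithin] with Y hY hYst
    exact heq ▸ hmin' hY hYst
  · have := norm_pos_iff.2 (hw X hX (hmem X hq) hne)
    positivity

end Landing

theorem mainTheorem2 (n p : ℕ) (hpn : p ≤ n)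
    (f : Matrix (Fin n) (Fin p) ℝ → ℝ) (hf : ContDiff ℝ 1 f)
    (hf_lip : LocallyLipschitz (∇ f))
    (lam : ℝ) (hlam : 0 < lam)
    (Xs : Matrix (Fin n) (Fin p) ℝ)
    (hmin : IsLocalMinOn f (Landing.stiefel n p) Xs)
    (hcrit : Landing.IsIsolatedCriticalPoint f Xs) :
    Landing.IsAsymptoticallyStable (fun X => -Landing.landingField f lam X) Xs := by
  obtain ⟨ε, M, H⟩ := Landing.exists_isCascadeLyapunov hf hf_lip hlam hmin hcrit
  refine H.isAsymptoticallyStable (Landing.locallyLipschitz_neg_landingField hf_lip lam) ?_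
  simp [Landing.landingField_eq, Landing.mem_stiefel_iff_defect.1 hcrit.1.1,
    Landing.psi_eq_zero_of_mem_criticalPoints (hf.differentiable one_ne_zero) hcrit.1]
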